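/- Let $\mathbb K$ be an algebraically closed field. A degree $e$ product of linear forms is a polynomial $c\,g_1\cdots g_e$ with $c\in\mathbb K$ and each $g_j$ a homogeneous linear form, zero being allowed (for $e=0$: a constant). For $d\ge 2$ and $m\ge 0$, property $C^d_m$ says the following. Suppose that in a polynomial ring over $\mathbb K$ in finitely many variables $$\ell_1+\dots+\ell_m=\sum_{i=0}^m f_i x_i ,$$ where $x_0,\dots,x_m$ are pairwise coprime squarefree monomials of degree at most $d$, each $\ell_j$ is a degree $d$ product of linear forms, each $f_i$ is a degree $d-\deg x_i$ product of linear forms, and $\deg x_i+\deg x_j\ge d+2$ for all $i\ne j$. Then $f_i=0$ for some $i$. For $r\ge 2$ and $d\ge 3$ let $$X_{r,d}=V\Big(\sum_{i=1}^r\prod_{j=1}^d x_{ij}\Big)\subset\mathbb P^{rd-1}_{\mathbb K}.$$ For $k\ge 0$ let $\mathbf F_k(X_{r,d})$ be its Fano scheme of projective $k$-planes. It is called $n$-split if for every $k$-plane $L\subset X_{r,d}$ there are $1\le\lambda\le n$ and $1\le a_1<\dots<a_\lambda\le r$ with $L\subset V\big(\sum_{i=1}^{\lambda}\prod_{j=1}^d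 x_{a_i j}\big)$. **Theorem.** 1. Property $C^d_m$ holds for all $d\ge 2$ and $m\ge 0$ such that $m\le 2$ or $d\le 4$. 2. Let $r\ge 2$ and $d\ge 3$ with $r\le 6$ or $d=4$. Then, for every integer $k\ge 0$: - (one-splitting) $\mathbf F_k(X_{r,d})$ is one-split (that is, $1$-split) if and only if $k\ge \frac r2 d$ (when $r$ is even), respectively $k\ge\frac{r-1}2 d+1$ (when $r$ is odd); - (two-splitting) if $r$ is even and $k\ge\frac r2 d-1$, then $\mathbf F_k(X_{r,d})$ is two-split (that is, $2$-split). -/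

import Mathlib

noncomputable section

namespace SumProd

open MvPolynomial

/-- `p` is a degree `e` product of linear forms: a scalar times a product of `e` homogeneous
linear forms. Linear forms, the scalar, and hence `p`, may be zero. The scalar can be absorbed when
`0 < e`; for `e = 0` the products of linear forms are exactly the constants. -/
def IsProdLinearForms {K σ : Type*} [Field K] (e : ℕ) (p : MvPolynomial σ K) : Prop :=
  ∃ (c : K) (g : Fin e → MvPolynomial σ K),
    (∀ j, (g j).IsHomogeneous 1) ∧ p = C c * ∏ j, g j

/-- The squarefree monomial with set of variables `S`. Its degree is `S.card`, and two such
monomials are coprime exactly if their sets of variables are disjoint. -/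
def sqfreeMonomial (K : Type*) {σ : Type*} [Field K] (S : Finset σ) : MvPolynomial σ K :=
  ∏ s ∈ S, X s

/-- Property `C^d_m` over `K`: whenever `ℓ₁ + ⋯ + ℓ_m = ∑_{i=0}^m f_i x_i` in a polynomial ring
over `K`, where the `ℓ_j` are degree `d` products of linear forms, the `x_i` are pairwise coprime
squarefree monomials with `deg x_i + deg x_j ≥ d + 2` for `i ≠ j`, and the `f_i` are degree
`d - deg x_i` products of linear forms, some `f_i` is zero. -/
def PropertyC (K : Type*) [Field K] (d m : ℕ) : Prop :=
  ∀ (n : ℕ) (l : Fin m → MvPolynomial (Fin n) K) (f : Fin (m + 1) → MvPolynomial (Fin n) K)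
    (S : Fin (m + 1) → Finset (Fin n)),
    (∀ j, IsProdLinearForms d (l j)) →
    (∀ i, (S i).card ≤ d) →
    (∀ i, IsProdLinearForms (d - (S i).card) (f i)) →
    (∀ i j, i ≠ j → Disjoint (S i) (S j)) →
    (∀ i j, i ≠ j → d + 2 ≤ (S i).card + (S j).card) →
    ∑ j, l j = ∑ i, f i * sqfreeMonomial K (S i) →
    ∃ i, f i = 0

/-- The set of points of projective space with coordinates indexed by `σ` at which the
(homogeneous) polynomial `F` vanishes. -/
def projZeroLocus {K σ : Type*} [Field K] (F : MvPolynomial σ K) :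
    Set (Projectivization K (σ → K)) :=
  {p | ∀ v ∈ p.submodule, eval v F = 0}

/-- The points of the projectivization of the vector subspace `W`. -/
def projPoints {K σ : Type*} [Field K] (W : Submodule K (σ → K)) :
    Set (Projectivization K (σ → K)) :=
  {p | p.submodule ≤ W}

/-- The form `∑_{i ∈ A} ∏_{j=1}^d x_{ij}` in the `r * d` variables `x_{ij}`. -/
def sumProdForm (K : Type*) [Field K] (r d : ℕ) (A : Finset (Fin r)) :
    MvPolynomial (Fin r × Fin d) K :=
  ∑ i ∈ A, ∏ j : Fin d, X (i, j)

/-- The hypersurface `X_{r,d} = V(∑_{i=1}^r ∏_{j=1}^d x_{ij})` in projective `(r d - 1)`-space. -/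
def hypersurfaceX (K : Type*) [Field K] (r d : ℕ) :
    Set (Projectivization K (Fin r × Fin d → K)) :=
  projZeroLocus (sumProdForm K r d Finset.univ)

/-- The (closed points of the) Fano scheme `F_k(X)`: the projective `k`-planes contained in `X`,
each given by the vector subspace of dimension `k + 1` of which it is the projectivization. -/
def fanoPlanes {K σ : Type*} [Field K] (k : ℕ) (X : Set (Projectivization K (σ → K))) :
    Set (Submodule K (σ → K)) :=
  {W | Module.finrank K W = k + 1 ∧ projPoints W ⊆ X}

/-- The plane `W` admits a `t`-splitting: for some `a_1 < ⋯ < a_t` it is contained in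
`V(∑_{i=1}^t ∏_{j=1}^d x_{a_i j})`. -/
def AdmitsSplitting {K : Type*} [Field K] {r d : ℕ} (t : ℕ)
    (W : Submodule K (Fin r × Fin d → K)) : Prop :=
  ∃ A : Finset (Fin r), A.card = t ∧ projPoints W ⊆ projZeroLocus (sumProdForm K r d A)

/-- `F_k(X_{r,d})` is `m`-split: every `k`-plane of `X_{r,d}` admits a `t`-splitting for some
`1 ≤ t ≤ m`. -/
def IsSplit (K : Type*) [Field K] (r d k m : ℕ) : Prop :=
  ∀ W ∈ fanoPlanes k (hypersurfaceX K r d), ∃ t, 1 ≤ t ∧ t ≤ m ∧ AdmitsSplitting t W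

/-- The one-splitting conjecture for `(r, d)` over `K`. -/
def OneSplitting (K : Type*) [Field K] (r d : ℕ) : Prop :=
  ∀ k : ℕ, IsSplit K r d k 1 ↔ (if Even r then r / 2 * d else (r - 1) / 2 * d + 1) ≤ k

/-- The two-splitting conjecture for `(r, d)` over `K`; it only concerns even `r`. -/
def TwoSplitting (K : Type*) [Field K] (r d : ℕ) : Prop :=
  Even r → ∀ k : ℕ, r / 2 * d - 1 ≤ k → IsSplit K r d k 2

end SumProd

end

/-! Everything rests on a rank bound. Let a sum of products of at most `d` linear forms vanish, with
no nonempty proper subsum vanishing and no zero term. If it has `b` terms, all the forms involved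
together have rank at most `b + d - 2`. To see this, move one term to the other side: the remaining
sum is invariant under the common kernel of that term's factors, which has codimension at most `d`,
and `finrank_add_one_le_of_invariant` shows that at most `b - 1 - 1` further conditions kill all the
other factors.

For Property C, a suitably chosen minimal relation contains more terms `f_i x_i` than terms `ℓ_j`.
The variables of its coprime monomials are independent and force a rank exceeding the bound.

For splittings, the relation restricted to a plane breaks into `t` minimal ones, so the underlying
vector space has dimension at most `r + t (d - 2)`. Without one-splittings each piece has at least
two terms, so `t ≤ r / 2`; without two-splittings as well, `3 t ≤ r`. Sharpness comes from linear
spaces on which the `r` products cancel in pairs, with one triple if `r` is odd. -/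

noncomputable section

/-! ### Rank bounds for vanishing sums of products of linear forms -/

namespace SumProd

open Module

variable {K W ι : Type*} [Field K] [AddCommGroup W] [Module K W]

/-- The function `P` behaves like a scalar multiple of a product of linear forms whose distinct
factors form the finite set `G`. -/
def HasLinearFactors (G : Finset (Dual K W)) (P : W → K) : Prop :=
  (∀ φ ∈ G, ∀ w, φ w = 0 → P w = 0) ∧ ∀ n w, (∀ φ ∈ G, φ n = 0) → P (w + n) = P w

/-- The common kernel of the finite sets `G a` of linear forms for `a ∈ B`. -/
def commonKer (G : ι → Finset (Dual K W)) (B : Finset ι) : Submodule K W :=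
  ⨅ a ∈ B, ⨅ φ ∈ G a, LinearMap.ker φ

theorem mem_commonKer {G : ι → Finset (Dual K W)} {B : Finset ι} {w : W} :
    w ∈ commonKer G B ↔ ∀ a ∈ B, ∀ φ ∈ G a, φ w = 0 := by
  simp [commonKer, Submodule.mem_iInf]

theorem finrank_le_finrank_inf_ker_add_one [FiniteDimensional K W] (N : Submodule K W)
    (φ : Dual K W) : finrank K N ≤ finrank K ↥(N ⊓ LinearMap.ker φ) + 1 := by
  have h1 := Submodule.finrank_sup_add_finrank_inf_eq N (LinearMap.ker φ)
  have h2 := LinearMap.finrank_range_add_finrank_ker φ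
  have h3 : finrank K (LinearMap.range φ) ≤ 1 := by
    simpa using Submodule.finrank_le (LinearMap.range φ)
  have h4 := Submodule.finrank_le (N ⊔ LinearMap.ker φ)
  omega

theorem finrank_le_finrank_iInf_ker_add_card [FiniteDimensional K W] (s : Finset (Dual K W)) :
    finrank K W ≤ finrank K ↥(⨅ φ ∈ s, LinearMap.ker φ) + s.card := by
  classical
  induction s using Finset.induction_on with
  | empty =>
    rw [show (⨅ φ ∈ (∅ : Finset (Dual K W)), LinearMap.ker φ) = ⊤ by simp, finrank_top]
    exact Nat.le_add_right _ _
  | insert φ s hφ ih =>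
    rw [Finset.iInf_insert, Finset.card_insert_of_notMem hφ, inf_comm]
    have := finrank_le_finrank_inf_ker_add_one (⨅ ψ ∈ s, LinearMap.ker ψ) φ
    omega

/-- Induction on `B`. If a factor `p` of some term is nonzero on `N`, restricting to `ker p` costs
one dimension and kills a subsum `D`, which is taken maximal. On the hyperplane the rest `B \ D`
satisfies the hypotheses again; once its factors are killed, the sum over `D` is invariant on all of
`L`. The total cost is `1 + (|B \ D| - 1) + (|D| - 1) = |B| - 1`. The ambient space `L` is kept
separate from `N` because the two recursive calls use different ones. -/
theorem finrank_add_one_le_of_invariant [FiniteDimensional K W] {G : ι → Finset (Dual K W)}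
    {P : ι → W → K} (hP : ∀ a, HasLinearFactors (G a) (P a)) (B : Finset ι) (hB : B.Nonempty)
    (L N : Submodule K W) (hNL : N ≤ L)
    (hmin : ∀ T ⊆ B, T.Nonempty → ∃ w ∈ L, ∑ a ∈ T, P a w ≠ 0)
    (hinv : ∀ n ∈ N, ∀ w ∈ L, ∑ a ∈ B, P a (w + n) = ∑ a ∈ B, P a w) :
    finrank K N + 1 ≤ finrank K ↥(N ⊓ commonKer G B) + B.card := by
  classical
  induction hc : B.card using Nat.strong_induction_on generalizing B L N with
  | _ b ih =>
  subst hc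
  by_cases hN : N ≤ commonKer G B
  · rw [inf_eq_left.2 hN]
    have := hB.card_pos
    omega
  obtain ⟨x, hxN, hx⟩ := SetLike.not_le_iff_exists.1 hN
  simp only [mem_commonKer, not_forall] at hx
  obtain ⟨a₀, ha₀, p, hp, hpx⟩ := hx
  set L' := L ⊓ LinearMap.ker p with hL'
  set N' := N ⊓ LinearMap.ker p with hN'
  obtain ⟨D, hDB, hD⟩ := (B.powerset.filter
    fun D => ∀ w ∈ L', ∑ a ∈ D, P a w = 0).exists_le_maximal (a := ∅) (by simp)
  obtain ⟨hDB, hD0⟩ : D ⊆ B ∧ ∀ w ∈ L', ∑ a ∈ D, P a w = 0 := by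
    simpa using hD.prop
  have hDmax : ∀ T ⊆ B \ D, T.Nonempty → ∃ w ∈ L', ∑ a ∈ T, P a w ≠ 0 := by
    intro T hT hTne
    by_contra! h
    have hdisj : Disjoint D T := by
      rw [Finset.disjoint_left]
      intro a haD haT
      exact (Finset.mem_sdiff.1 (hT haT)).2 haD
    have hmem : D ∪ T ∈ B.powerset.filter fun D => ∀ w ∈ L', ∑ a ∈ D, P a w = 0 := by
      rw [Finset.mem_filter, Finset.mem_powerset]
      refine ⟨Finset.union_subset hDB (hT.trans Finset.sdiff_subset), fun w hw => ?_⟩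
      rw [Finset.sum_union hdisj, hD0 w hw, h w hw, add_zero]
    obtain ⟨a, ha⟩ := hTne
    have := hD.le_of_ge hmem Finset.subset_union_left (Finset.mem_union_right D ha)
    exact (Finset.mem_sdiff.1 (hT ha)).2 this
  have ha₀D : a₀ ∈ D := by
    by_contra h
    obtain ⟨w, hw, hne⟩ := hDmax {a₀} (by simp [ha₀, h]) (by simp)
    exact hne (by simpa using (hP a₀).1 p hp w hw.2)
  -- If `D = B`, every point of `L` can be moved along `x` into `ker p` without changing the sum,
  -- which would then vanish on all of `L`.
  have hC : (B \ D).Nonempty := by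
    by_contra h
    rw [Finset.not_nonempty_iff_eq_empty, Finset.sdiff_eq_empty_iff_subset] at h
    obtain rfl := Finset.Subset.antisymm hDB h
    obtain ⟨w, hw, hne⟩ := hmin D le_rfl hB
    have hn : -(p w / p x) • x ∈ N := N.smul_mem _ hxN
    apply hne
    rw [← hinv _ hn w hw]
    refine hD0 _ ⟨L.add_mem hw (hNL hn), ?_⟩
    simp [hpx]
  have hcard := Finset.card_sdiff_add_card_eq_card hDB
  have hCpos := hC.card_pos
  have hDne : D.Nonempty := ⟨a₀, ha₀D⟩
  have hDpos := hDne.card_pos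
  have h1 := ih (B \ D).card (by omega) (B \ D) hC L' N' (inf_le_inf_right _ hNL) hDmax
    (fun n hn w hw => by
      have e := hinv n hn.1 w hw.1
      rw [← Finset.sum_sdiff hDB, ← Finset.sum_sdiff hDB,
        hD0 w hw, hD0 (w + n) (L'.add_mem hw ⟨hNL hn.1, hn.2⟩)] at e
      simpa using e) rfl
  have h2 := ih D.card (by omega) D hDne L (N' ⊓ commonKer G (B \ D))
    (inf_le_left.trans (inf_le_left.trans hNL))
    (fun T hT => hmin T (hT.trans hDB))
    (fun n hn w hw => by
      have e := hinv n hn.1.1 w hw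
      rw [← Finset.sum_sdiff hDB, ← Finset.sum_sdiff hDB] at e
      have e' : ∑ a ∈ B \ D, P a (w + n) = ∑ a ∈ B \ D, P a w :=
        Finset.sum_congr rfl fun a ha => (hP a).2 n w (mem_commonKer.1 hn.2 a ha)
      rw [e'] at e
      exact add_left_cancel e) rfl
  have h3 := finrank_le_finrank_inf_ker_add_one N p
  rw [← hN'] at h3
  have h4 : N' ⊓ commonKer G (B \ D) ⊓ commonKer G D = N ⊓ commonKer G B := by
    ext w
    simp only [hN', Submodule.mem_inf, mem_commonKer, LinearMap.mem_ker]
    constructor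
    · rintro ⟨⟨⟨hw, -⟩, h1⟩, h2⟩
      refine ⟨hw, fun a ha => ?_⟩
      by_cases haD : a ∈ D
      · exact h2 a haD
      · exact h1 a (Finset.mem_sdiff.2 ⟨ha, haD⟩)
    · rintro ⟨hw, h⟩
      exact ⟨⟨⟨hw, h a₀ ha₀ p hp⟩, fun a ha => h a (Finset.mem_sdiff.1 ha).1⟩,
        fun a ha => h a (hDB ha)⟩
  rw [h4] at h2
  omega

/-- A minimal vanishing sum of products of at most `d` linear forms has small rank. -/
theorem finrank_add_two_le_of_minimal [FiniteDimensional K W] {G : ι → Finset (Dual K W)}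
    {P : ι → W → K} (hP : ∀ a, HasLinearFactors (G a) (P a)) {d : ℕ}
    (hd : ∀ a, (G a).card ≤ d) (B : Finset ι) (hB : B.Nonempty)
    (hne : ∀ a ∈ B, ∃ w, P a w ≠ 0) (hsum : ∀ w, ∑ a ∈ B, P a w = 0)
    (hmin : ∀ T ⊂ B, T.Nonempty → ∃ w, ∑ a ∈ T, P a w ≠ 0) :
    finrank K W + 2 ≤ finrank K (commonKer G B) + B.card + d := by
  classical
  obtain ⟨a₀, ha₀⟩ := hB
  -- The sum of the other terms inherits the invariance of `P a₀` under the common kernel of `G a₀`.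
  have hsplit : ∀ w, ∑ a ∈ B.erase a₀, P a w = -P a₀ w := fun w => by
    have := Finset.sum_erase_add B (fun a => P a w) ha₀
    rw [hsum] at this
    exact eq_neg_of_add_eq_zero_left this
  have hne' : (B.erase a₀).Nonempty := by
    by_contra h
    rw [Finset.not_nonempty_iff_eq_empty] at h
    obtain ⟨w, hw⟩ := hne a₀ ha₀
    have := hsplit w
    rw [h, Finset.sum_empty] at this
    exact hw (neg_eq_zero.1 this.symm)
  have h := finrank_add_one_le_of_invariant hP (B.erase a₀) hne' ⊤
    (⨅ φ ∈ G a₀, LinearMap.ker φ) le_top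
    (fun T hT hTne => by
      obtain ⟨w, hw⟩ := hmin T (hT.trans_ssubset (Finset.erase_ssubset ha₀)) hTne
      exact ⟨w, trivial, hw⟩)
    (fun n hn w _ => by
      rw [hsplit, hsplit, (hP a₀).2 n w (by simpa [Submodule.mem_iInf] using hn)])
  have h2 := finrank_le_finrank_iInf_ker_add_card (G a₀)
  have h3 : (⨅ φ ∈ G a₀, LinearMap.ker φ) ⊓ commonKer G (B.erase a₀) = commonKer G B := by
    ext w
    simp only [Submodule.mem_inf, mem_commonKer, Submodule.mem_iInf, LinearMap.mem_ker,
      Finset.mem_erase]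
    constructor
    · rintro ⟨h1, h2⟩ a ha
      by_cases haa : a = a₀
      · exact haa ▸ h1
      · exact h2 a ⟨haa, ha⟩
    · exact fun h => ⟨h a₀ ha₀, fun a ha => h a ha.2⟩
  rw [h3, Finset.card_erase_of_mem ha₀] at h
  have := hd a₀
  have := Finset.card_pos.2 ⟨a₀, ha₀⟩
  omega

/-- A vanishing sum of nonzero products of at most `d` linear forms decomposes into `k` minimal
vanishing sums; this bounds its rank. -/
theorem exists_finrank_le_of_sum_eq_zero [FiniteDimensional K W] {G : ι → Finset (Dual K W)}
    {P : ι → W → K} (hP : ∀ a, HasLinearFactors (G a) (P a)) {d : ℕ} (hd2 : 2 ≤ d)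
    (hd : ∀ a, (G a).card ≤ d) (B : Finset ι)
    (hne : ∀ a ∈ B, ∃ w, P a w ≠ 0) (hsum : ∀ w, ∑ a ∈ B, P a w = 0) :
    ∃ k, 2 * k ≤ B.card ∧
      ((∀ T ⊆ B, T.card = 2 → ∃ w, ∑ a ∈ T, P a w ≠ 0) → 3 * k ≤ B.card) ∧
      finrank K W ≤ finrank K (commonKer G B) + B.card + k * (d - 2) := by
  classical
  induction hc : B.card using Nat.strong_induction_on generalizing B with
  | _ b ih =>
  subst hc
  rcases B.eq_empty_or_nonempty with rfl | hB
  · refine ⟨0, by simp, by simp, ?_⟩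
    have : commonKer G (∅ : Finset ι) = ⊤ := by simp [commonKer]
    rw [this, finrank_top]
    simp
  obtain ⟨T, -, hT⟩ := (B.powerset.filter
    fun T => T.Nonempty ∧ ∀ w, ∑ a ∈ T, P a w = 0).exists_le_minimal (a := B) (by simp [hB, hsum])
  obtain ⟨hTB, hTne, hT0⟩ : T ⊆ B ∧ T.Nonempty ∧ ∀ w, ∑ a ∈ T, P a w = 0 := by
    simpa using hT.prop
  have h1 := finrank_add_two_le_of_minimal hP hd T hTne (fun a ha => hne a (hTB ha)) hT0
    (fun T' hT' hne' => by
      by_contra! h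
      have : T' ∈ B.powerset.filter fun T => T.Nonempty ∧ ∀ w, ∑ a ∈ T, P a w = 0 := by
        rw [Finset.mem_filter, Finset.mem_powerset]
        exact ⟨hT'.subset.trans hTB, hne', h⟩
      exact hT'.not_subset (hT.le_of_le this hT'.subset))
  have hT1 : T.card ≠ 1 := by
    intro h
    obtain ⟨a, rfl⟩ := Finset.card_eq_one.1 h
    obtain ⟨w, hw⟩ := hne a (hTB (by simp))
    exact hw (by simpa using hT0 w)
  have hTpos := hTne.card_pos
  have hcard := Finset.card_sdiff_add_card_eq_card hTB
  obtain ⟨k, hk2, hk3, hk⟩ := ih (B \ T).card (by omega) (B \ T)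
    (fun a ha => hne a (Finset.mem_sdiff.1 ha).1)
    (fun w => by
      have := Finset.sum_sdiff (f := fun a => P a w) hTB
      rw [hT0, hsum, add_zero] at this
      exact this) rfl
  -- The piece `T` has at least two terms, and at least three if no pair cancels; it adds at most
  -- `T.card + (d - 2)` to the rank.
  refine ⟨k + 1, by omega, fun h => ?_, ?_⟩
  · have h3 := hk3 fun T' hT' => h T' (hT'.trans Finset.sdiff_subset)
    have hT2 : T.card ≠ 2 := fun h2 => by
      obtain ⟨w, hw⟩ := h T hTB h2
      exact hw (hT0 w)
    omega
  · have h5 : commonKer G T ⊓ commonKer G (B \ T) = commonKer G B := by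
      ext w
      simp only [Submodule.mem_inf, mem_commonKer, Finset.mem_sdiff]
      constructor
      · rintro ⟨h1, h2⟩ a ha
        by_cases haT : a ∈ T
        · exact h1 a haT
        · exact h2 a ⟨ha, haT⟩
      · exact fun h => ⟨fun a ha => h a (hTB ha), fun a ha => h a ha.1⟩
    have h6 := Submodule.finrank_sup_add_finrank_inf_eq (commonKer G T) (commonKer G (B \ T))
    have h7 := Submodule.finrank_le (commonKer G T ⊔ commonKer G (B \ T))
    rw [h5] at h6
    have h8 : (k + 1) * (d - 2) = k * (d - 2) + (d - 2) := by ring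
    omega

end SumProd

end

/-! ### Products of linear forms as functions, and Property C -/

noncomputable section

namespace SumProd

open Module

theorem hasLinearFactors_prod {K W : Type*} [Field K] [AddCommGroup W] [Module K W]
    [DecidableEq (Dual K W)] {κ : Type*} (s : Finset κ) (g : κ → Dual K W) (c : K) :
    HasLinearFactors (s.image g) fun w => c * ∏ j ∈ s, g j w := by
  constructor
  · intro φ hφ w hw
    obtain ⟨j, hj, rfl⟩ := Finset.mem_image.1 hφ
    exact mul_eq_zero_of_right c (Finset.prod_eq_zero hj hw)
  · intro n w h
    refine congrArg (c * ·) (Finset.prod_congr rfl fun j hj => ?_)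
    rw [map_add, h _ (Finset.mem_image_of_mem g hj), add_zero]

theorem HasLinearFactors.mul {K W : Type*} [Field K] [AddCommGroup W] [Module K W]
    [DecidableEq (Dual K W)] {G H : Finset (Dual K W)} {P Q : W → K}
    (hP : HasLinearFactors G P) (hQ : HasLinearFactors H Q) :
    HasLinearFactors (G ∪ H) fun w => P w * Q w := by
  constructor
  · intro φ hφ w hw
    rcases Finset.mem_union.1 hφ with h | h
    · exact mul_eq_zero_of_left (hP.1 φ h w hw) _
    · exact mul_eq_zero_of_right _ (hQ.1 φ h w hw)
  · intro n w h
    exact congrArg₂ (· * ·) (hP.2 n w fun φ hφ => h φ (Finset.mem_union_left _ hφ))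
      (hQ.2 n w fun φ hφ => h φ (Finset.mem_union_right _ hφ))

section PropertyC

open MvPolynomial

variable {K : Type*} [Field K]

/-- Evaluation of a homogeneous linear polynomial as a linear form. -/
theorem exists_dual_eq_eval {n : ℕ} {g : MvPolynomial (Fin n) K} (hg : g.IsHomogeneous 1) :
    ∃ φ : Dual K (Fin n → K), ∀ w, φ w = eval w g := by
  have hg' : g ∈ homogeneousSubmodule (Fin n) K 1 := hg
  rw [homogeneousSubmodule_one_eq_span_X] at hg'
  clear hg
  induction hg' using Submodule.span_induction with
  | mem g hg =>
    obtain ⟨i, rfl⟩ := hg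
    exact ⟨LinearMap.proj i, fun w => (eval_X i).symm⟩
  | zero => exact ⟨0, fun w => by simp⟩
  | add p q _ _ hp hq =>
    obtain ⟨φ, hφ⟩ := hp
    obtain ⟨ψ, hψ⟩ := hq
    exact ⟨φ + ψ, fun w => by simp [hφ, hψ]⟩
  | smul a p _ hp =>
    obtain ⟨φ, hφ⟩ := hp
    exact ⟨a • φ, fun w => by simp [hφ, smul_eval]⟩

theorem IsProdLinearForms.exists_hasLinearFactors {n e : ℕ} {p : MvPolynomial (Fin n) K}
    (hp : IsProdLinearForms e p) :
    ∃ G : Finset (Dual K (Fin n → K)), G.card ≤ e ∧ HasLinearFactors G fun w => eval w p := by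
  classical
  obtain ⟨c, g, hg, rfl⟩ := hp
  choose φ hφ using fun j => exists_dual_eq_eval (hg j)
  refine ⟨Finset.univ.image φ, Finset.card_image_le.trans (by simp), ?_⟩
  convert hasLinearFactors_prod Finset.univ φ c using 2 with w
  simp [hφ]

theorem finrank_add_card_le {n : ℕ} (N : Submodule K (Fin n → K)) (S : Finset (Fin n))
    (h : ∀ w ∈ N, ∀ s ∈ S, w s = 0) : finrank K N + S.card ≤ n := by
  classical
  let f : N →ₗ[K] ({s // s ∉ S} → K) :=
    (LinearMap.funLeft K K (Subtype.val : {s // s ∉ S} → Fin n)).comp N.subtype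
  have hf : Function.Injective f := by
    rw [← LinearMap.ker_eq_bot, LinearMap.ker_eq_bot']
    intro w hw
    ext s
    by_cases hs : s ∈ S
    · exact h _ w.2 s hs
    · exact congrFun hw ⟨s, hs⟩
  have := LinearMap.finrank_le_finrank_of_injective hf
  rw [finrank_fintype_fun_eq_card, Fintype.card_subtype_compl, Fintype.card_fin,
    Fintype.card_coe] at this
  have := S.card_le_univ
  rw [Fintype.card_fin] at this
  omega

/-- Sum the hypothesis over ordered pairs: each `b i` occurs `2 (|J| - 1)` times, and the positive
factor `|J| - 1` cancels. -/
theorem card_mul_le_two_mul_sum {ι : Type*} (J : Finset ι) (b : ι → ℕ) (c : ℕ)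
    (hJ : 2 ≤ J.card) (h : ∀ i ∈ J, ∀ j ∈ J, i ≠ j → c ≤ b i + b j) :
    J.card * c ≤ 2 * ∑ i ∈ J, b i := by
  classical
  have h1 : ∑ i ∈ J, ∑ j ∈ J.erase i, c ≤ ∑ i ∈ J, ∑ j ∈ J.erase i, (b i + b j) :=
    Finset.sum_le_sum fun i hi => Finset.sum_le_sum fun j hj =>
      h i hi j (Finset.mem_of_mem_erase hj) (Finset.ne_of_mem_erase hj).symm
  have h2 : ∑ i ∈ J, ∑ j ∈ J.erase i, c = J.card * ((J.card - 1) * c) := by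
    rw [Finset.sum_congr rfl fun i hi => by
      rw [Finset.sum_const, Finset.card_erase_of_mem hi, smul_eq_mul], Finset.sum_const,
      smul_eq_mul]
  have h3 : ∑ i ∈ J, ∑ j ∈ J.erase i, (b i + b j) + 2 * ∑ i ∈ J, b i
      = 2 * (J.card * ∑ i ∈ J, b i) := by
    have h4 : ∀ i ∈ J, ∑ j ∈ J.erase i, (b i + b j) + 2 * b i
        = J.card * b i + ∑ j ∈ J, b j := by
      intro i hi
      have h5 := Finset.sum_erase_add J (fun j => b i + b j) hi
      rw [Finset.sum_add_distrib (s := J), Finset.sum_const, smul_eq_mul] at h5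
      omega
    rw [Finset.mul_sum, ← Finset.sum_add_distrib, Finset.sum_congr rfl h4,
      Finset.sum_add_distrib, Finset.sum_const, ← Finset.mul_sum, smul_eq_mul]
    ring
  obtain ⟨t, ht⟩ := Nat.exists_eq_add_of_le hJ
  rw [ht] at h2 h3 ⊢
  have h6 : (1 + t) * ((2 + t) * c) ≤ (1 + t) * (2 * ∑ i ∈ J, b i) := by
    have : 2 + t - 1 = 1 + t := by omega
    rw [this] at h2
    nlinarith
  exact Nat.le_of_mul_le_mul_left h6 (by omega)

theorem propertyC [Infinite K] {d m : ℕ} (hd2 : 2 ≤ d) : PropertyC K d m := by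
  classical
  intro n l f S hl hS hf hdisj hdeg heq
  by_contra! hf0
  choose Gl hGl hPl using fun j => (hl j).exists_hasLinearFactors
  choose Gf hGf hPf using fun i => (hf i).exists_hasLinearFactors
  let Gx : Fin (m + 1) → Finset (Dual K (Fin n → K)) := fun i =>
    (S i).image fun s => LinearMap.proj s
  let G : Fin m ⊕ Fin (m + 1) → Finset (Dual K (Fin n → K)) :=
    Sum.elim Gl fun i => Gf i ∪ Gx i
  let P : Fin m ⊕ Fin (m + 1) → (Fin n → K) → K :=
    Sum.elim (fun j w => -eval w (l j)) fun i w => eval w (f i) * eval w (sqfreeMonomial K (S i))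
  have hP : ∀ a, HasLinearFactors (G a) (P a) := by
    rintro (j | i)
    · refine ⟨fun φ hφ w hw => ?_, fun x w hx => ?_⟩
      · exact neg_eq_zero.2 ((hPl j).1 φ hφ w hw)
      · exact congrArg Neg.neg ((hPl j).2 x w hx)
    · refine (hPf i).mul ?_
      have h1 := hasLinearFactors_prod (S i)
        (fun s => (LinearMap.proj s : Dual K (Fin n → K))) 1
      simpa only [sqfreeMonomial, map_prod, eval_X, one_mul, LinearMap.proj_apply] using h1
  have hG : ∀ a, (G a).card ≤ d := by
    rintro (j | i)
    · exact hGl j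
    · refine (Finset.card_union_le _ _).trans ?_
      have h1 := hGf i
      have h2 : (Gx i).card ≤ (S i).card := Finset.card_image_le
      have h3 := hS i
      omega
  have hsqf : ∀ i, f i * sqfreeMonomial K (S i) ≠ 0 := fun i =>
    mul_ne_zero (hf0 i) (Finset.prod_ne_zero_iff.2 fun s _ => X_ne_zero s)
  -- Zero `l j` are dropped so that every term of the relation is nonzero; the right-hand terms
  -- still outnumber the left-hand ones.
  let B₀ : Finset (Fin m ⊕ Fin (m + 1)) :=
    (Finset.univ.filter fun j => l j ≠ 0).disjSum Finset.univ
  have hne : ∀ a ∈ B₀, ∃ w, P a w ≠ 0 := by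
    rintro (j | i) ha
    · have hj : l j ≠ 0 := by simpa [B₀] using ha
      by_contra! h
      exact hj (MvPolynomial.funext fun w => by simpa [P] using h w)
    · by_contra! h
      exact hsqf i (MvPolynomial.funext fun w => by simpa [P] using h w)
  have hsum : ∀ w, ∑ a ∈ B₀, P a w = 0 := by
    intro w
    have h1 := congrArg (eval w) heq
    simp only [map_sum, map_mul] at h1
    rw [Finset.sum_disjSum]
    simp only [P, Sum.elim_inl, Sum.elim_inr]
    rw [← h1, Finset.sum_neg_distrib, Finset.sum_filter_of_ne, neg_add_cancel]
    intro j _ hj h0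
    exact hj (by rw [h0, map_zero])
  -- Minimality is imposed only among vanishing subsums with more terms on the right than on the
  -- left. Such a `B` has no nonempty proper vanishing subsum at all: of `T` and `B \ T`, one would
  -- again have more terms on the right.
  obtain ⟨B, hBB, hB⟩ := (B₀.powerset.filter fun T =>
    T.toLeft.card < T.toRight.card ∧ ∀ w, ∑ a ∈ T, P a w = 0).exists_le_minimal (a := B₀) (by
      simp only [Finset.mem_filter, Finset.mem_powerset_self, true_and]
      refine ⟨?_, hsum⟩
      simp only [B₀, Finset.toLeft_disjSum, Finset.toRight_disjSum, Finset.card_univ,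
        Fintype.card_fin]
      have := Finset.card_filter_le (Finset.univ : Finset (Fin m)) fun j => l j ≠ 0
      simp only [Finset.card_univ, Fintype.card_fin] at this
      omega)
  obtain ⟨hBsub, hBlt, hB0⟩ : B ⊆ B₀ ∧ B.toLeft.card < B.toRight.card ∧
      ∀ w, ∑ a ∈ B, P a w = 0 := by simpa using hB.prop
  have hcard := B.card_toLeft_add_card_toRight
  have hBne : B.Nonempty := Finset.card_pos.1 (by omega)
  have hmin : ∀ T ⊂ B, ¬ (T.toLeft.card < T.toRight.card ∧ ∀ w, ∑ a ∈ T, P a w = 0) := by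
    intro T hT h
    have : T ∈ B₀.powerset.filter fun T =>
        T.toLeft.card < T.toRight.card ∧ ∀ w, ∑ a ∈ T, P a w = 0 := by
      rw [Finset.mem_filter, Finset.mem_powerset]
      exact ⟨hT.subset.trans hBsub, h⟩
    exact hT.not_subset (hB.le_of_le this hT.subset)
  have hrank := finrank_add_two_le_of_minimal hP hG B hBne (fun a ha => hne a (hBsub ha)) hB0
    (fun T hT hTne => by
      by_contra! h
      have h1 : ¬ T.toLeft.card < T.toRight.card := fun h1 => hmin T hT ⟨h1, h⟩
      have hsd : B \ T ⊂ B := Finset.sdiff_ssubset hT.subset hTne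
      refine hmin _ hsd ⟨?_, fun w => ?_⟩
      · have hl := Finset.card_sdiff_add_card_eq_card
          (Finset.toLeft_subset_toLeft hT.subset)
        have hr := Finset.card_sdiff_add_card_eq_card
          (Finset.toRight_subset_toRight hT.subset)
        rw [Finset.toLeft_sdiff, Finset.toRight_sdiff]
        omega
      · have := Finset.sum_sdiff (f := fun a => P a w) hT.subset
        rw [h w, hB0 w, add_zero] at this
        exact this)
  have hright : 2 ≤ B.toRight.card := by
    by_contra hlt
    have hB1 : B.card = 1 := by omega
    obtain ⟨a, rfl⟩ := Finset.card_eq_one.1 hB1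
    obtain ⟨w, hw⟩ := hne a (hBsub (by simp))
    exact hw (by simpa using hB0 w)
  have h1 := finrank_add_card_le (commonKer G B) (B.toRight.biUnion S) (by
    intro w hw s hs
    obtain ⟨i, hi, his⟩ := Finset.mem_biUnion.1 hs
    exact mem_commonKer.1 hw (Sum.inr i) (Finset.mem_toRight.1 hi) (LinearMap.proj s)
      (Finset.mem_union_right _ (Finset.mem_image.2 ⟨s, his, rfl⟩)))
  rw [Finset.card_biUnion fun i _ j _ hij => hdisj i j hij] at h1
  have h2 := card_mul_le_two_mul_sum B.toRight (fun i => (S i).card) (d + 2) hright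
    fun i _ j _ hij => hdeg i j hij
  rw [finrank_fintype_fun_eq_card, Fintype.card_fin] at hrank
  -- With `s = B.toRight.card`, the rank is at least `s (d + 2) / 2` and at most `(2 s - 1) + d -
  -- 2`. Hence `(s - 2) (d - 2) + 2 ≤ 0`, which is impossible.
  have h3 : (B.toRight.card - 2) * d + 2 * d = B.toRight.card * d := by
    rw [← add_mul]; congr 1; omega
  have h4 : (B.toRight.card - 2) * 2 ≤ (B.toRight.card - 2) * d := Nat.mul_le_mul_left _ hd2
  rw [mul_add] at h2
  omega

end PropertyC

end SumProd

end

/-! ### Planes of large dimension split -/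

noncomputable section

namespace SumProd

open Module

section Splitting

variable {K : Type*} [Field K] {r d : ℕ}

theorem projPoints_subset_projZeroLocus_iff (hd : d ≠ 0) (W : Submodule K (Fin r × Fin d → K))
    (A : Finset (Fin r)) :
    projPoints W ⊆ projZeroLocus (sumProdForm K r d A) ↔
      ∀ w ∈ W, ∑ i ∈ A, ∏ j, w (i, j) = 0 := by
  have heval : ∀ w, MvPolynomial.eval w (sumProdForm K r d A) = ∑ i ∈ A, ∏ j, w (i, j) := by
    simp [sumProdForm]
  constructor
  · intro h w hw
    -- The zero vector is not a projective point; there the equation holds because `d ≠ 0` makes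
    -- each product vanish.
    by_cases hw0 : w = 0
    · subst hw0
      simp [hd]
    · rw [← heval]
      refine h (a := Projectivization.mk K w hw0) ?_ w ?_
      · simpa [projPoints, Projectivization.submodule_mk] using hw
      · simp [Projectivization.submodule_mk]
  · intro h p hp w hw
    rw [heval]
    exact h w (hp hw)

theorem exists_finrank_le_of_forall_sum_prod_eq_zero (hd : 2 ≤ d)
    (W : Submodule K (Fin r × Fin d → K)) (hne : ∀ i, ∃ w ∈ W, ∏ j, w (i, j) ≠ 0)
    (hsum : ∀ w ∈ W, ∑ i, ∏ j, w (i, j) = 0) :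
    ∃ k, 2 * k ≤ r ∧
      ((∀ T : Finset (Fin r), T.card = 2 → ∃ w ∈ W, ∑ i ∈ T, ∏ j, w (i, j) ≠ 0) → 3 * k ≤ r) ∧
      finrank K W ≤ r + k * (d - 2) := by
  classical
  let g : Fin r → Fin d → Dual K W := fun i j => (LinearMap.proj (i, j)).comp W.subtype
  let G : Fin r → Finset (Dual K W) := fun i => Finset.univ.image (g i)
  have hG : ∀ i, (G i).card ≤ d := fun i => Finset.card_image_le.trans (by simp)
  have hP : ∀ i, HasLinearFactors (G i) fun w : W => ∏ j, w.1 (i, j) := fun i => by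
    have h := hasLinearFactors_prod Finset.univ (g i) 1
    simp only [one_mul] at h
    exact h
  obtain ⟨k, h1, h2, h3⟩ := exists_finrank_le_of_sum_eq_zero hP hd hG Finset.univ
    (fun i _ => by
      obtain ⟨w, hw, h⟩ := hne i
      exact ⟨⟨w, hw⟩, h⟩)
    (fun w => hsum w.1 w.2)
  rw [Finset.card_univ, Fintype.card_fin] at h1 h2 h3
  refine ⟨k, h1, fun h => h2 fun T _ hT => ?_, ?_⟩
  · obtain ⟨w, hw, h'⟩ := h T hT
    exact ⟨⟨w, hw⟩, h'⟩
  -- The factors include all coordinates, so the rank is the full dimension of `W`.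
  · have hbot : commonKer G Finset.univ = ⊥ := by
      rw [eq_bot_iff]
      intro w hw
      rw [Submodule.mem_bot]
      ext ⟨i, j⟩
      exact mem_commonKer.1 hw i (Finset.mem_univ i) (g i j)
        (Finset.mem_image_of_mem _ (Finset.mem_univ j))
    rw [hbot, finrank_bot] at h3
    omega

/-- The bound of the one-splitting statement, uniformly in the parity of `r`. -/
theorem ite_even_eq (hd : 2 ≤ d) :
    (if Even r then r / 2 * d else (r - 1) / 2 * d + 1) = r + r / 2 * (d - 2) := by
  obtain ⟨e, rfl⟩ := Nat.exists_eq_add_of_le hd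
  rcases Nat.even_or_odd' r with ⟨q, rfl | rfl⟩
  · have h1 : 2 * q / 2 = q := by omega
    rw [if_pos (even_two_mul q), h1, Nat.add_sub_cancel_left]
    ring
  · have h1 : (2 * q + 1) / 2 = q := by omega
    rw [if_neg (by simp), h1, Nat.add_sub_cancel_left, Nat.add_sub_cancel,
      Nat.mul_div_cancel_left _ two_pos]
    ring

theorem isSplit_one_of_le (hd : 2 ≤ d) {k : ℕ} (hk : r + r / 2 * (d - 2) ≤ k) :
    IsSplit K r d k 1 := by
  rintro W ⟨hW, hX⟩
  have hd0 : d ≠ 0 := by omega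
  rw [hypersurfaceX, projPoints_subset_projZeroLocus_iff hd0] at hX
  refine ⟨1, le_rfl, le_rfl, ?_⟩
  by_contra hno
  obtain ⟨t, h2, -, h⟩ := exists_finrank_le_of_forall_sum_prod_eq_zero hd W (fun i => by
    by_contra! h
    refine hno ⟨{i}, by simp, ?_⟩
    rw [projPoints_subset_projZeroLocus_iff hd0]
    simpa using h) hX
  have h3 : t * (d - 2) ≤ r / 2 * (d - 2) := Nat.mul_le_mul_right _ (by omega)
  omega

theorem twoSplitting (hr : 2 ≤ r) (hd : 3 ≤ d) : TwoSplitting K r d := by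
  rintro heven k hk W ⟨hW, hX⟩
  have hd0 : d ≠ 0 := by omega
  rw [hypersurfaceX, projPoints_subset_projZeroLocus_iff hd0] at hX
  by_contra! hno
  have hno1 : ∀ T : Finset (Fin r), 1 ≤ T.card → T.card ≤ 2 →
      ∃ w ∈ W, ∑ i ∈ T, ∏ j, w (i, j) ≠ 0 := by
    intro T h1 h2
    by_contra! h
    exact hno T.card h1 h2 ⟨T, rfl, (projPoints_subset_projZeroLocus_iff hd0 W T).2 h⟩
  obtain ⟨t, h2, h3, h⟩ := exists_finrank_le_of_forall_sum_prod_eq_zero (by omega) W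
    (fun i => by simpa using hno1 {i} (by simp) (by simp)) hX
  have h3 := h3 fun T hT => hno1 T (by omega) (by omega)
  have h4 := ite_even_eq (r := r) (d := d) (by omega)
  rw [if_pos heven] at h4
  obtain ⟨s, hs⟩ := heven
  -- Since `r` is even and positive, `3 t ≤ r` gives `t + 1 ≤ r / 2`. The gain `d - 2 ≥ 1` pays for
  -- lowering the bound on `k` by one.
  have h5 : (t + 1) * (d - 2) ≤ r / 2 * (d - 2) := Nat.mul_le_mul_right _ (by omega)
  rw [add_mul] at h5
  omega

/-! ### Planes of small dimension that do not one-split -/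

theorem exists_finrank_eq_of_mem {V : Type*} [AddCommGroup V] [Module K V]
    [FiniteDimensional K V] (E : Submodule K V) {v : V} (hv : v ∈ E) (hv0 : v ≠ 0) {k : ℕ}
    (hk : k + 1 ≤ finrank K E) : ∃ W ≤ E, v ∈ W ∧ finrank K W = k + 1 := by
  induction k with
  | zero =>
    exact ⟨K ∙ v, (Submodule.span_singleton_le_iff_mem v E).2 hv,
      Submodule.mem_span_singleton_self v, finrank_span_singleton hv0⟩
  | succ k ih =>
    obtain ⟨W, hWE, hvW, hW⟩ := ih (by omega)
    have hlt : ¬ E ≤ W := fun h => by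
      have := Submodule.finrank_mono h
      omega
    obtain ⟨x, hxE, hxW⟩ := SetLike.not_le_iff_exists.1 hlt
    have hx0 : x ≠ 0 := fun h => hxW (h ▸ W.zero_mem)
    refine ⟨W ⊔ K ∙ x, sup_le hWE ((Submodule.span_singleton_le_iff_mem x E).2 hxE),
      Submodule.mem_sup_left hvW, ?_⟩
    have h1 := Submodule.finrank_sup_add_finrank_inf_eq W (K ∙ x)
    rw [((Submodule.disjoint_span_singleton' hx0).2 hxW).eq_bot, finrank_bot,
      finrank_span_singleton hx0, hW] at h1
    exact h1

/-- A one-splitting makes a single product vanish on the plane, which fails at `v`; subspaces of `E`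
through `v` exist in every dimension from one up to that of `E`. -/
theorem not_isSplit_one_of_submodule (hr : r ≠ 0) (hd : d ≠ 0) (E : Submodule K (Fin r × Fin d → K))
    (hE : ∀ w ∈ E, ∑ i, ∏ j, w (i, j) = 0) {v : Fin r × Fin d → K} (hvE : v ∈ E)
    (hv : ∀ x, v x ≠ 0) {k : ℕ} (hk : k + 1 ≤ finrank K E) : ¬ IsSplit K r d k 1 := by
  intro hs
  obtain ⟨W, hWE, hvW, hW⟩ := exists_finrank_eq_of_mem E hvE (fun h =>
    hv (⟨0, Nat.pos_of_ne_zero hr⟩, ⟨0, Nat.pos_of_ne_zero hd⟩) (congrFun h _)) hk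
  obtain ⟨t, h1, h2, A, hA, hWA⟩ := hs W ⟨hW, by
    rw [hypersurfaceX, projPoints_subset_projZeroLocus_iff hd]
    exact fun w hw => hE w (hWE hw)⟩
  obtain ⟨i, rfl⟩ := Finset.card_eq_one.1 (by omega : A.card = 1)
  rw [projPoints_subset_projZeroLocus_iff hd] at hWA
  have := hWA v hvW
  rw [Finset.sum_singleton] at this
  exact Finset.prod_ne_zero_iff.2 (fun j _ => hv (i, j)) this

/-- Points whose coordinates `w (i, j)` with `j ≠ 0` are constant on each fibre of `β`, and whose
coordinates `w (i, 0)` sum to zero on each fibre, satisfy the equation of the hypersurface. -/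
theorem exists_submodule_of_fibres {q e : ℕ} (β : Fin r → Fin q) (ρ : Fin q → Fin r)
    (hρ : ∀ b, β (ρ b) = b) (c : Fin r → K) (hc : ∀ i, c i ≠ 0)
    (hcβ : ∀ b, ∑ i with β i = b, c i = 0) :
    ∃ E : Submodule K (Fin r × Fin (e + 1) → K),
      (∀ w ∈ E, ∑ i, ∏ j, w (i, j) = 0) ∧ (∃ v ∈ E, ∀ x, v x ≠ 0) ∧
      r * (e + 1) ≤ finrank K E + ((r - q) * e + q) := by
  classical
  let φ : Fin r × Fin e → Dual K (Fin r × Fin (e + 1) → K) := fun x =>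
    (LinearMap.proj (x.1, x.2.succ) : Dual K (Fin r × Fin (e + 1) → K)) -
      LinearMap.proj (ρ (β x.1), x.2.succ)
  let ψ : Fin q → Dual K (Fin r × Fin (e + 1) → K) := fun b =>
    ∑ i with β i = b, (LinearMap.proj (i, 0) : Dual K (Fin r × Fin (e + 1) → K))
  -- The equations `φ` are trivial at the fibre representatives `ρ b`, so only `(r - q) * e` of them
  -- count.
  let I : Finset (Fin r) := (Finset.univ.image ρ)ᶜ
  let s : Finset (Dual K (Fin r × Fin (e + 1) → K)) :=
    (I ×ˢ Finset.univ).image φ ∪ Finset.univ.image ψ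
  have hmem : ∀ w, w ∈ (⨅ f ∈ s, LinearMap.ker f) ↔
      (∀ i j, w (i, Fin.succ j) = w (ρ (β i), j.succ)) ∧ ∀ b, ∑ i with β i = b, w (i, 0) = 0 := by
    intro w
    simp only [Submodule.mem_iInf, LinearMap.mem_ker]
    constructor
    · intro h
      refine ⟨fun i j => ?_, fun b => ?_⟩
      · by_cases hi : i ∈ I
        · have := h (φ (i, j)) (Finset.mem_union_left _ (Finset.mem_image_of_mem _ (by simp [hi])))
          simpa [φ, sub_eq_zero] using this
        · obtain ⟨b, rfl⟩ : ∃ b, ρ b = i := by simpa [I] using hi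
          rw [hρ]
      · have := h (ψ b) (Finset.mem_union_right _ (Finset.mem_image_of_mem _ (by simp)))
        simpa [ψ] using this
    · rintro ⟨h1, h2⟩ f hf
      rcases Finset.mem_union.1 hf with hf | hf
      · obtain ⟨⟨i, j⟩, -, rfl⟩ := Finset.mem_image.1 hf
        simp [φ, h1 i j]
      · obtain ⟨b, -, rfl⟩ := Finset.mem_image.1 hf
        simpa [ψ] using h2 b
  refine ⟨⨅ f ∈ s, LinearMap.ker f, fun w hw => ?_, ⟨fun x => Fin.cases (c x.1) (fun _ => 1) x.2,
    ?_, ?_⟩, ?_⟩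
  · obtain ⟨h1, h2⟩ := (hmem w).1 hw
    rw [← Finset.sum_fiberwise Finset.univ β]
    refine Finset.sum_eq_zero fun b _ => ?_
    have h3 : ∀ i ∈ Finset.univ.filter (β · = b),
        ∏ j, w (i, j) = w (i, 0) * ∏ j : Fin e, w (ρ b, j.succ) := by
      intro i hi
      rw [Fin.prod_univ_succ]
      congr 1
      refine Finset.prod_congr rfl fun j _ => ?_
      rw [h1, (Finset.mem_filter.1 hi).2]
    rw [Finset.sum_congr rfl h3, ← Finset.sum_mul, h2, zero_mul]
  · rw [hmem]
    exact ⟨fun i j => by simp, fun b => by simpa using hcβ b⟩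
  · rintro ⟨i, j⟩
    refine Fin.cases (hc i) (fun _ => one_ne_zero) j
  · have h1 := finrank_le_finrank_iInf_ker_add_card s
    rw [finrank_fintype_fun_eq_card, Fintype.card_prod, Fintype.card_fin, Fintype.card_fin] at h1
    have hI : I.card = r - q := by
      rw [Finset.card_compl, Fintype.card_fin,
        Finset.card_image_of_injective _ (Function.LeftInverse.injective hρ), Finset.card_univ,
        Fintype.card_fin]
    have h2 : s.card ≤ (r - q) * e + q := by
      refine (Finset.card_union_le _ _).trans (Nat.add_le_add ?_ ?_)
      · refine Finset.card_image_le.trans ?_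
        rw [Finset.card_product, hI, Finset.card_univ, Fintype.card_fin]
      · exact Finset.card_image_le.trans (by simp)
    omega

theorem not_isSplit_one_of_lt [Infinite K] (hr : 2 ≤ r) (hd : 2 ≤ d) {k : ℕ}
    (hk : k < r + r / 2 * (d - 2)) : ¬ IsSplit K r d k 1 := by
  classical
  obtain ⟨e, rfl⟩ := Nat.exists_eq_add_of_le' (by omega : 1 ≤ d)
  -- This choice makes `1`, `t`, `-1 - t` nonzero numbers with sum zero, as needed for a fibre of
  -- three elements.
  obtain ⟨t, ht⟩ := Infinite.exists_notMem_finset ({0, -1} : Finset K)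
  obtain ⟨ht0, ht1⟩ : t ≠ 0 ∧ t ≠ -1 := by simpa using ht
  set q := r / 2 with hq
  -- Consecutive indices are paired; for odd `r` the minimum puts the leftover index `2 * q` into
  -- the last fibre. The values `c` are `1, -1` on a pair and `1, t, -1 - t` on the triple.
  let β : Fin r → Fin q := fun i => ⟨min (i / 2) (q - 1), by omega⟩
  let ρ : Fin q → Fin r := fun b => ⟨2 * b, by omega⟩
  let c : Fin r → K := fun i =>
    if i.1 = 2 * q then -1 - t else if i.1 % 2 = 0 then 1
    else if i.1 + 2 = r then t else -1
  obtain ⟨E, hE, ⟨v, hvE, hv⟩, hfin⟩ := exists_submodule_of_fibres (e := e) β ρ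
    (fun b => by ext; simp only [β, ρ]; omega) c
    (fun i => by
      simp only [c]
      split_ifs
      · intro h
        exact ht1 (by linear_combination -h)
      · exact one_ne_zero
      · exact ht0
      · exact neg_ne_zero.2 one_ne_zero)
    (fun b => by
      have hb := b.2
      by_cases hlast : b.1 + 1 = q ∧ 2 * q + 1 = r
      · have h1 : (Finset.univ.filter (β · = b)) =
            {⟨2 * b, by omega⟩, ⟨2 * b + 1, by omega⟩, ⟨2 * b + 2, by omega⟩} := by
          ext i
          simp only [β, Finset.mem_filter, Finset.mem_univ, true_and, Finset.mem_insert,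
            Finset.mem_singleton, Fin.ext_iff]
          omega
        rw [h1, Finset.sum_insert (by simp), Finset.sum_insert (by simp),
          Finset.sum_singleton]
        simp only [c]
        rw [if_neg (by omega), if_pos (by omega), if_neg (by omega), if_neg (by omega),
          if_pos (by omega), if_pos (by omega)]
        ring
      · have h1 : (Finset.univ.filter (β · = b)) =
            {⟨2 * b, by omega⟩, ⟨2 * b + 1, by omega⟩} := by
          ext i
          have := i.2
          simp only [β, Finset.mem_filter, Finset.mem_univ, true_and, Finset.mem_insert,
            Finset.mem_singleton, Fin.ext_iff]
          omega
        rw [h1, Finset.sum_insert (by simp), Finset.sum_singleton]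
        simp only [c]
        rw [if_neg (by omega), if_pos (by omega), if_neg (by omega), if_neg (by omega),
          if_neg (by omega)]
        ring)
  refine not_isSplit_one_of_submodule (by omega) (by omega) E hE hvE hv ?_
  obtain ⟨u, rfl⟩ := Nat.exists_eq_add_of_le' (by omega : 1 ≤ e)
  -- With `d = e + 1`, the dimension of `E` is at least `r d - (r - q) (d - 1) - q = r + q (d - 2)`,
  -- exactly the bound.
  obtain ⟨p, hp⟩ := Nat.exists_eq_add_of_le (by omega : q ≤ r)
  rw [show r - q = p by omega] at hfin
  rw [show u + 1 + 1 - 2 = u by omega] at hk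
  have : r * (u + 1 + 1) = (q + p) * (u + 1 + 1) := by rw [← hp]
  have : (q + p) * (u + 1 + 1) = q * u + q + (p * (u + 1) + q) + p := by ring
  omega

theorem oneSplitting [Infinite K] (hr : 2 ≤ r) (hd : 2 ≤ d) : OneSplitting K r d := by
  intro k
  rw [ite_even_eq hd]
  refine ⟨fun h => ?_, isSplit_one_of_le hd⟩
  by_contra hk
  exact not_isSplit_one_of_lt hr hd (not_le.1 hk) h

end Splitting

end SumProd

end

theorem mainTheorem1 (K : Type*) [Field K] [IsAlgClosed K] :
    (∀ d m : ℕ, 2 ≤ d → (m ≤ 2 ∨ d ≤ 4) → SumProd.PropertyC K d m) ∧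
    (∀ r d : ℕ, 2 ≤ r → 3 ≤ d → (r ≤ 6 ∨ d = 4) →
      SumProd.OneSplitting K r d ∧ SumProd.TwoSplitting K r d) := by
  have : Infinite K := IsAlgClosed.instInfinite
  exact ⟨fun d m hd _ => SumProd.propertyC hd, fun r d hr hd _ =>
    ⟨SumProd.oneSplitting hr (by omega), SumProd.twoSplitting hr hd⟩⟩
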